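/- Let $G$ be a finite simple connected bipartite graph with at least two vertices. A maximum stable set is an independent set of vertices of maximum cardinality $\alpha(G)$. The graph $G$ is $\alpha^+$-stable if $\alpha(G+e)=\alpha(G)$ for every edge $e$ of the complement $\overline{G}$. A graph $H$ is bistable bipartite if it has a bipartition $V(H)=A\sqcup B$ into stable sets such that $A\neq B$ and the maximum stable sets of $H$ are exactly $A$ and $B$. Then $G$ is $\alpha^+$-stable if and only if there are $k\ge 1$ and pairwise vertex-disjoint subgraphs $G_1,\dots,G_k$ of $G$ with $V(G)=V(G_1)\cup\dots\cup V(G_k)$ such that every $G_i$ is bistable bipartite (edges of $G$ between different $G_i$ are allowed). The same equivalence holds if the subgraphs $G_i$ are required to be induced. -/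

import Mathlib

/-- `G` is `α⁺`-stable: adding any edge of the complement does not change the stability number. -/
def IsAlphaPlusStable {V : Type*} (G : SimpleGraph V) : Prop :=
  ∀ e ∈ Gᶜ.edgeSet, (G ⊔ SimpleGraph.fromEdgeSet {e}).indepNum = G.indepNum

/-- `G` is bistable bipartite: it has a bipartition `{A, B}` of its vertex set such that the
maximum stable sets of `G` are exactly the two (distinct) sets `A` and `B`. -/
def IsBistableBipartite {V : Type*} [Finite V] (G : SimpleGraph V) : Prop :=
  ∃ A B : Finset V, G.IsBipartiteWith (A : Set V) (B : Set V) ∧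
    (A : Set V) ∪ (B : Set V) = Set.univ ∧ A ≠ B ∧
    ∀ S : Finset V, G.IsMaximumIndepSet S ↔ S = A ∨ S = B

/-- The subgraphs `H i` are pairwise vertex-disjoint and together cover all vertices of `G`.
Edges of `G` between different `H i` are allowed. -/
structure IsVertexDecomposition {V ι : Type*} {G : SimpleGraph V} (H : ι → G.Subgraph) :
    Prop where
  disjoint : ∀ i j, i ≠ j → Disjoint (H i).verts (H j).verts
  cover : ⋃ i, (H i).verts = Set.univ

/-!
A graph is `α⁺`-stable iff no two distinct vertices lie in all of its maximum stable sets. In a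
bipartite graph, two maximum stable sets `S` and `T` recombine into a maximum stable set that is
`S ∩ T` on one colour class and `S ∪ T` on the other. Hence some maximum stable set meets the first
class only in vertices common to all maximum stable sets; under `α⁺`-stability there is at most one
such vertex, and exchanging it for a neighbour shows that the other class is a maximum stable set.
So `2 * α(G) ≤ |V|`, and by Hall's theorem this gives a perfect matching, whose edges span induced
bistable copies of `K₂`. Conversely, a stable set contains at most half of each bistable part, so
`2 * α(G) ≤ |V|` again; then both colour classes are maximum stable sets, and they are disjoint.
-/

open scoped Finset

open SimpleGraph

section IndepSet

variable {V : Type*} {G : SimpleGraph V} [Finite V]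

theorem isMaximumIndepSet_of_indepNum_le {S : Finset V} (hS : G.IsIndepSet (S : Set V))
    (hcard : G.indepNum ≤ #S) : G.IsMaximumIndepSet S :=
  ⟨hS, fun _ hT ↦ hT.card_le_indepNum.trans hcard⟩

theorem ncard_le_indepNum_of_isIndepSet {S : Set V} (hS : G.IsIndepSet S) :
    S.ncard ≤ G.indepNum := by
  rw [Set.ncard_eq_toFinset_card S]
  exact IsIndepSet.card_le_indepNum (by simpa using hS)

theorem indepNum_anti {G' : SimpleGraph V} (h : G ≤ G') : G'.indepNum ≤ G.indepNum := by
  obtain ⟨S, hS⟩ := G'.exists_isNIndepSet_indepNum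
  rw [← hS.card_eq]
  exact IsIndepSet.card_le_indepNum (hS.isIndepSet.mono' fun _ _ hn hadj ↦ hn (h hadj))

end IndepSet

section Core

variable {V : Type*} {G : SimpleGraph V}

/-- The core of `G`: the intersection of all its maximum stable sets. Its size controls
`α⁺`-stability. -/
def indepCore [Finite V] (G : SimpleGraph V) : Set V :=
  {v | ∀ S, G.IsMaximumIndepSet S → v ∈ S}

theorem isIndepSet_sup_edge_iff {x y : V} (hxy : x ≠ y) {S : Set V} :
    (G ⊔ edge x y).IsIndepSet S ↔ G.IsIndepSet S ∧ ¬(x ∈ S ∧ y ∈ S) := by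
  constructor
  · intro hS
    refine ⟨hS.mono' fun _ _ hn hadj ↦ hn (Or.inl hadj), fun ⟨hx, hy⟩ ↦ ?_⟩
    exact hS hx hy hxy (Or.inr (by simp [edge_adj, hxy]))
  · rintro ⟨hS, hnot⟩ u hu v hv huv (hadj | hadj)
    · exact hS hu hv huv hadj
    · rw [edge_adj] at hadj
      rcases hadj.1 with ⟨rfl, rfl⟩ | ⟨rfl, rfl⟩
      exacts [hnot ⟨hu, hv⟩, hnot ⟨hv, hu⟩]

variable [Finite V]

theorem indepNum_sup_edge_eq_iff {x y : V} (hxy : x ≠ y) :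
    (G ⊔ edge x y).indepNum = G.indepNum ↔
      ∃ S, G.IsMaximumIndepSet S ∧ ¬(x ∈ S ∧ y ∈ S) := by
  constructor
  · intro hα
    obtain ⟨S, hS⟩ := (G ⊔ edge x y).exists_isNIndepSet_indepNum
    obtain ⟨hSG, hnot⟩ := (isIndepSet_sup_edge_iff hxy).1 hS.isIndepSet
    exact ⟨S, isMaximumIndepSet_of_indepNum_le hSG (hα.ge.trans hS.card_eq.ge), hnot⟩
  · rintro ⟨S, hS, hnot⟩
    refine (indepNum_anti le_sup_left).antisymm ?_
    rw [← maximumIndepSet_card_eq_indepNum S hS]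
    exact IsIndepSet.card_le_indepNum ((isIndepSet_sup_edge_iff hxy).2 ⟨hS.isIndepSet, hnot⟩)

theorem isAlphaPlusStable_iff_subsingleton_indepCore :
    IsAlphaPlusStable G ↔ (indepCore G).Subsingleton := by
  constructor
  · intro hst x hx y hy
    by_contra hxy
    obtain ⟨S, hS⟩ := G.maximumIndepSet_exists
    have hnadj : ¬G.Adj x y := hS.isIndepSet (hx S hS) (hy S hS) hxy
    obtain ⟨T, hT, hnot⟩ :=
      (indepNum_sup_edge_eq_iff hxy).1 (hst s(x, y) (by simp [hxy, hnadj]))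
    exact hnot ⟨hx T hT, hy T hT⟩
  · intro hcore e he
    induction e with | _ x y
    have hxy : x ≠ y := (Gᶜ.mem_edgeSet.1 he).ne
    refine (indepNum_sup_edge_eq_iff hxy).2 ?_
    by_contra! hboth
    exact hxy (hcore (fun S hS ↦ (hboth S hS).1) fun S hS ↦ (hboth S hS).2)

end Core

section Uncross

variable {V : Type*} {G : SimpleGraph V}

open Classical in
/-- The set that agrees with `S ∩ T` on `X` and with `S ∪ T` off `X`, used to recombine two stable
sets of a graph with bipartition `{X, Xᶜ}`. -/
noncomputable def uncross (X : Set V) (S T : Finset V) : Finset V :=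
  {v ∈ S ∪ T | v ∈ X → v ∈ S ∩ T}

theorem mem_uncross {X : Set V} {S T : Finset V} {v : V} :
    v ∈ uncross X S T ↔ (v ∈ S ∨ v ∈ T) ∧ (v ∈ X → v ∈ S ∧ v ∈ T) := by
  simp [uncross]

theorem isIndepSet_uncross {X : Set V} (hXc : G.IsIndepSet Xᶜ) {S T : Finset V}
    (hS : G.IsIndepSet (S : Set V)) (hT : G.IsIndepSet (T : Set V)) :
    G.IsIndepSet (uncross X S T : Set V) := by
  have not_adj_of_mem_inter : ∀ u v, u ∈ S ∧ u ∈ T → v ∈ S ∨ v ∈ T → ¬G.Adj u v := by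
    rintro u v ⟨huS, huT⟩ (hv | hv) huv
    exacts [hS huS hv huv.ne huv, hT huT hv huv.ne huv]
  intro u hu v hv hne huv
  rw [SetLike.mem_coe, mem_uncross] at hu hv
  by_cases huX : u ∈ X
  · exact not_adj_of_mem_inter u v (hu.2 huX) hv.1 huv
  by_cases hvX : v ∈ X
  · exact not_adj_of_mem_inter v u (hv.2 hvX) hu.1 huv.symm
  exact hXc huX hvX hne huv

theorem card_uncross_add_card_uncross_compl (X : Set V) (S T : Finset V) :
    #(uncross X S T) + #(uncross Xᶜ S T) = #S + #T := by
  classical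
  have hunion : uncross X S T ∪ uncross Xᶜ S T = S ∪ T := by
    ext v
    simp only [Finset.mem_union, mem_uncross, Set.mem_compl_iff]
    tauto
  have hinter : uncross X S T ∩ uncross Xᶜ S T = S ∩ T := by
    ext v
    simp only [Finset.mem_inter, mem_uncross, Set.mem_compl_iff]
    tauto
  rw [← Finset.card_union_add_card_inter, hunion, hinter, Finset.card_union_add_card_inter]

variable [Finite V] {X : Set V}

theorem isMaximumIndepSet_uncross (hX : G.IsIndepSet X) (hXc : G.IsIndepSet Xᶜ) {S T : Finset V}
    (hS : G.IsMaximumIndepSet S) (hT : G.IsMaximumIndepSet T) :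
    G.IsMaximumIndepSet (uncross X S T) := by
  have hcompl : #(uncross Xᶜ S T) ≤ #T :=
    hT.maximum _ (isIndepSet_uncross (by rwa [compl_compl]) hS.isIndepSet hT.isIndepSet)
  have hsum := card_uncross_add_card_uncross_compl X S T
  have hα := maximumIndepSet_card_eq_indepNum S hS
  exact isMaximumIndepSet_of_indepNum_le (isIndepSet_uncross hXc hS.isIndepSet hT.isIndepSet)
    (by omega)

theorem exists_isMaximumIndepSet_inter_subset_indepCore (hX : G.IsIndepSet X)
    (hXc : G.IsIndepSet Xᶜ) : ∃ S, G.IsMaximumIndepSet S ∧ (S : Set V) ∩ X ⊆ indepCore G := by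
  obtain ⟨S, hS, hmin⟩ := Set.Finite.exists_minimalFor (fun S : Finset V ↦ (S : Set V) ∩ X)
    {S | G.IsMaximumIndepSet S} (Set.toFinite _) G.maximumIndepSet_exists
  refine ⟨S, hS, fun v hv T hT ↦ ?_⟩
  have hle : (uncross X S T : Set V) ∩ X ⊆ (S : Set V) ∩ X :=
    fun w ⟨hw, hwX⟩ ↦ ⟨((mem_uncross.1 hw).2 hwX).1, hwX⟩
  have hv' : v ∈ uncross X S T := (hmin (isMaximumIndepSet_uncross hX hXc hS hT) hle hv).1
  exact ((mem_uncross.1 hv').2 hv.2).2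

end Uncross

section Bipartition

variable {V : Type*} {G : SimpleGraph V}

theorem exists_isIndepSet_compl_of_isBipartite (h : G.IsBipartite) :
    ∃ X : Set V, G.IsIndepSet X ∧ G.IsIndepSet Xᶜ := by
  obtain ⟨X, Y, hXY⟩ := h.exists_isBipartiteWith
  refine ⟨X, fun u hu v hv _ huv ↦ ?_, fun u hu v hv _ huv ↦ ?_⟩
  · exact hXY.disjoint.notMem_of_mem_left hv (hXY.mem_of_mem_adj hu huv)
  · rcases hXY.mem_of_adj huv with ⟨huX, -⟩ | ⟨-, hvX⟩
    exacts [hu huX, hv hvX]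

theorem isBipartiteWith_compl {X : Set V} (hX : G.IsIndepSet X) (hXc : G.IsIndepSet Xᶜ) :
    G.IsBipartiteWith X Xᶜ := by
  refine ⟨disjoint_compl_right, fun u v huv ↦ ?_⟩
  have hnX : ¬(u ∈ X ∧ v ∈ X) := fun ⟨hu, hv⟩ ↦ hX hu hv huv.ne huv
  have hnXc : ¬(u ∈ Xᶜ ∧ v ∈ Xᶜ) := fun ⟨hu, hv⟩ ↦ hXc hu hv huv.ne huv
  simp only [Set.mem_compl_iff] at hnXc ⊢
  tauto

variable [Finite V] {X : Set V}

theorem indepNum_le_ncard_compl_of_subsingleton_indepCore (hX : G.IsIndepSet X)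
    (hXc : G.IsIndepSet Xᶜ) (hiso : ∀ v, ¬G.IsIsolated v) (hcore : (indepCore G).Subsingleton) :
    G.indepNum ≤ Xᶜ.ncard := by
  obtain ⟨S, hS, hsub⟩ := exists_isMaximumIndepSet_inter_subset_indepCore hX hXc
  have hexchange : ((S : Set V) ∩ X).ncard ≤ (Xᶜ \ S).ncard := by
    rcases (hcore.anti hsub).eq_empty_or_singleton with hempty | ⟨x, hx⟩
    · simp [hempty]
    · obtain ⟨hxS, hxX⟩ : x ∈ (S : Set V) ∩ X := hx ▸ Set.mem_singleton x
      obtain ⟨y, hxy⟩ := exists_adj_iff_not_isIsolated.2 (hiso x)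
      have hy : y ∈ Xᶜ \ S := ⟨fun hyX ↦ hX hxX hyX hxy.ne hxy,
        fun hyS ↦ hS.isIndepSet hxS hyS hxy.ne hxy⟩
      rw [hx, Set.ncard_singleton]
      exact (Set.ncard_pos).2 ⟨y, hy⟩
  calc G.indepNum = (S : Set V).ncard := by
        rw [Set.ncard_coe_finset, maximumIndepSet_card_eq_indepNum S hS]
    _ = ((S : Set V) ∩ X).ncard + ((S : Set V) \ X).ncard :=
        (Set.ncard_inter_add_ncard_sdiff_eq_ncard _ _).symm
    _ ≤ (Xᶜ \ S).ncard + (Xᶜ ∩ S).ncard := by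
        rw [Set.inter_comm Xᶜ, ← Set.sdiff_eq]
        exact Nat.add_le_add_right hexchange _
    _ = Xᶜ.ncard := by rw [add_comm, Set.ncard_inter_add_ncard_sdiff_eq_ncard]

theorem two_mul_indepNum_le_of_subsingleton_indepCore (hbip : G.IsBipartite)
    (hiso : ∀ v, ¬G.IsIsolated v) (hcore : (indepCore G).Subsingleton) :
    2 * G.indepNum ≤ Nat.card V := by
  obtain ⟨X, hX, hXc⟩ := exists_isIndepSet_compl_of_isBipartite hbip
  have hαXc := indepNum_le_ncard_compl_of_subsingleton_indepCore hX hXc hiso hcore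
  have hαX := indepNum_le_ncard_compl_of_subsingleton_indepCore hXc (by rwa [compl_compl]) hiso
    hcore
  rw [compl_compl] at hαX
  have hsum := Set.ncard_add_ncard_compl X
  omega

theorem indepNum_le_ncard_compl_of_two_mul_indepNum_le (hX : G.IsIndepSet X)
    (hα : 2 * G.indepNum ≤ Nat.card V) : G.indepNum ≤ Xᶜ.ncard := by
  have hle := ncard_le_indepNum_of_isIndepSet hX
  have hsum := Set.ncard_add_ncard_compl X
  omega

theorem indepCore_subset_compl_of_two_mul_indepNum_le (hX : G.IsIndepSet X)
    (hXc : G.IsIndepSet Xᶜ) (hα : 2 * G.indepNum ≤ Nat.card V) : indepCore G ⊆ Xᶜ := by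
  intro v hv
  have hmax : G.IsMaximumIndepSet Xᶜ.toFinite.toFinset :=
    isMaximumIndepSet_of_indepNum_le (by simpa using hXc) <| by
      rw [← Set.ncard_eq_toFinset_card Xᶜ]
      exact indepNum_le_ncard_compl_of_two_mul_indepNum_le hX hα
  simpa using hv _ hmax

theorem isAlphaPlusStable_of_two_mul_indepNum_le (hbip : G.IsBipartite)
    (hα : 2 * G.indepNum ≤ Nat.card V) : IsAlphaPlusStable G := by
  obtain ⟨X, hX, hXc⟩ := exists_isIndepSet_compl_of_isBipartite hbip
  have hcore : indepCore G ⊆ Xᶜ := indepCore_subset_compl_of_two_mul_indepNum_le hX hXc hα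
  have hcore' : indepCore G ⊆ Xᶜᶜ :=
    indepCore_subset_compl_of_two_mul_indepNum_le hXc (by rwa [compl_compl]) hα
  rw [isAlphaPlusStable_iff_subsingleton_indepCore]
  exact fun v hv ↦ absurd (hcore hv) (hcore' hv)

end Bipartition

section PerfectMatching

variable {V : Type*} {G : SimpleGraph V} [Finite V] {X : Set V}

theorem ncard_le_ncard_biUnion_neighborSet (hX : G.IsIndepSet X) (hXc : G.IsIndepSet Xᶜ)
    (hα : G.indepNum ≤ Xᶜ.ncard) {A : Set V} (hA : A ⊆ X) :
    A.ncard ≤ (⋃ a ∈ A, G.neighborSet a).ncard := by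
  set N := ⋃ a ∈ A, G.neighborSet a
  have hnadj : ∀ u ∈ A, ∀ v ∈ Xᶜ \ N, ¬G.Adj u v :=
    fun u hu v hv huv ↦ hv.2 (Set.mem_biUnion hu huv)
  have hindep : G.IsIndepSet (A ∪ Xᶜ \ N) := by
    refine Set.pairwise_union.2 ⟨hX.mono hA, hXc.mono Set.sdiff_subset, fun u hu v hv _ ↦ ?_⟩
    exact ⟨hnadj u hu v hv, fun hvu ↦ hnadj u hu v hv hvu.symm⟩
  have hdisj : Disjoint A (Xᶜ \ N) := disjoint_compl_right.mono hA Set.sdiff_subset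
  have hcard := ncard_le_indepNum_of_isIndepSet hindep
  rw [Set.ncard_union_eq hdisj] at hcard
  have hdiff := Set.ncard_le_ncard_sdiff_add_ncard Xᶜ N
  omega

theorem exists_isPerfectMatching_of_two_mul_indepNum_le (hbip : G.IsBipartite)
    (hα : 2 * G.indepNum ≤ Nat.card V) : ∃ M : G.Subgraph, M.IsPerfectMatching := by
  classical
  have := Fintype.ofFinite V
  obtain ⟨X, hX, hXc⟩ := exists_isIndepSet_compl_of_isBipartite hbip
  have hXY := isBipartiteWith_compl hX hXc
  refine exists_isPerfectMatching_of_forall_ncard_le hXY fun A ↦ ?_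
  have hdisj : Disjoint (⋃ a ∈ A ∩ X, G.neighborSet a) (⋃ a ∈ A \ X, G.neighborSet a) :=
    disjoint_compl_left.mono
      (Set.iUnion₂_subset fun a ha ↦ isBipartiteWith_neighborSet_subset hXY ha.2)
      (Set.iUnion₂_subset fun a ha ↦ isBipartiteWith_neighborSet_subset hXY.symm ha.2)
  calc A.ncard = (A ∩ X).ncard + (A \ X).ncard :=
        (Set.ncard_inter_add_ncard_sdiff_eq_ncard _ _).symm
    _ ≤ (⋃ a ∈ A ∩ X, G.neighborSet a).ncard + (⋃ a ∈ A \ X, G.neighborSet a).ncard :=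
        Nat.add_le_add
          (ncard_le_ncard_biUnion_neighborSet hX hXc
            (indepNum_le_ncard_compl_of_two_mul_indepNum_le hX hα) Set.inter_subset_right)
          (ncard_le_ncard_biUnion_neighborSet hXc (by rwa [compl_compl])
            (indepNum_le_ncard_compl_of_two_mul_indepNum_le hXc hα) fun a ha ↦ ha.2)
    _ = (⋃ a ∈ A, G.neighborSet a).ncard := by
        rw [← Set.ncard_union_eq hdisj, ← Set.biUnion_union, Set.inter_union_sdiff]

end PerfectMatching

section Decomposition

variable {V : Type*} {G : SimpleGraph V}

theorem isBistableBipartite_of_adj [Finite V] {a b : V} (hab : G.Adj a b)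
    (huniv : ∀ v, v = a ∨ v = b) : IsBistableBipartite G := by
  have hcard : ∀ S : Finset V, G.IsIndepSet (S : Set V) → #S ≤ 1 := by
    refine fun S hS ↦ Finset.card_le_one.2 fun u hu v hv ↦ by_contra fun hne ↦ hS hu hv hne ?_
    rcases huniv u with rfl | rfl <;> rcases huniv v with rfl | rfl
    exacts [absurd rfl hne, hab, hab.symm, absurd rfl hne]
  have hsingleton : ∀ v, G.IsMaximumIndepSet {v} := fun v ↦
    ⟨by simp [IsIndepSet], fun T hT ↦ by simpa using hcard T hT⟩
  have hbip : G.IsBipartiteWith {a} {b} := by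
    refine ⟨by simpa using hab.ne, fun v w hvw ↦ ?_⟩
    rcases huniv v with rfl | rfl <;> rcases huniv w with rfl | rfl <;> simp_all
  refine ⟨{a}, {b}, by simpa using hbip, ?_, by simpa using hab.ne, fun S ↦ ⟨fun hS ↦ ?_, ?_⟩⟩
  · ext v
    simpa [or_comm] using huniv v
  · have hone : 1 ≤ #S := by simpa using hS.maximum {a} (hsingleton a).isIndepSet
    obtain ⟨v, rfl⟩ := Finset.card_eq_one.1 ((hcard S hS.isIndepSet).antisymm hone)
    simpa using huniv v
  · rintro (rfl | rfl) <;> exact hsingleton _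

theorem IsBistableBipartite.two_mul_indepNum_le [Finite V] (hG : IsBistableBipartite G) :
    2 * G.indepNum ≤ Nat.card V := by
  classical
  have := Fintype.ofFinite V
  obtain ⟨A, B, hAB, -, -, hmax⟩ := hG
  have hA := maximumIndepSet_card_eq_indepNum A ((hmax A).2 (Or.inl rfl))
  have hB := maximumIndepSet_card_eq_indepNum B ((hmax B).2 (Or.inr rfl))
  have hcard := (A ∪ B).card_le_univ
  rw [Finset.card_union_of_disjoint (by simpa using hAB.disjoint)] at hcard
  rw [Nat.card_eq_fintype_card]
  omega

theorem ncard_inter_verts_le_indepNum [Finite V] (H : G.Subgraph) {S : Set V}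
    (hS : G.IsIndepSet S) : (S ∩ H.verts).ncard ≤ H.coe.indepNum := by
  have hpre : H.coe.IsIndepSet (Subtype.val ⁻¹' S) := fun u hu v hv hne huv ↦
    hS hu hv (Subtype.coe_ne_coe.2 hne) (H.adj_sub huv)
  rw [Set.inter_comm, ← Subtype.image_preimage_coe,
    Set.ncard_image_of_injective _ Subtype.val_injective]
  exact ncard_le_indepNum_of_isIndepSet hpre

theorem isBistableBipartite_induce_edge [Finite V] {e : Sym2 V} (he : e ∈ G.edgeSet) :
    IsBistableBipartite ((⊤ : G.Subgraph).induce (e : Set V)).coe := by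
  induction e with | _ x y
  refine isBistableBipartite_of_adj (a := ⟨x, Sym2.mem_mk_left x y⟩)
    (b := ⟨y, Sym2.mem_mk_right x y⟩) ⟨Sym2.mem_mk_left x y, Sym2.mem_mk_right x y, he⟩ ?_
  rintro ⟨v, hv⟩
  exact (Sym2.mem_iff.1 hv).imp Subtype.ext Subtype.ext

theorem isVertexDecomposition_induce_edge {M : G.Subgraph} (hM : M.IsPerfectMatching) :
    IsVertexDecomposition fun e : M.edgeSet ↦ (⊤ : G.Subgraph).induce (e : Sym2 V) where
  disjoint := by
    rintro ⟨e, he⟩ ⟨e', he'⟩ hne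
    refine Set.disjoint_left.2 fun v hv hv' ↦ hne ?_
    obtain ⟨w, rfl⟩ := Sym2.mem_iff_exists.1 hv
    obtain ⟨w', rfl⟩ := Sym2.mem_iff_exists.1 hv'
    obtain rfl := hM.1.eq_of_adj_left he he'
    rfl
  cover := by
    rw [← hM.2.verts_eq_univ, hM.1.verts_eq_biUnion_edgeSet, Set.biUnion_eq_iUnion]
    rfl

namespace IsVertexDecomposition

variable {ι κ : Type*} {H : ι → G.Subgraph}

theorem comp_equiv (hH : IsVertexDecomposition H) (e : κ ≃ ι) : IsVertexDecomposition (H ∘ e) where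
  disjoint i j hij := hH.disjoint _ _ (e.injective.ne hij)
  cover := by rw [← hH.cover]; exact e.surjective.iUnion_comp fun i ↦ (H i).verts

theorem nonempty_index [Nonempty V] (hH : IsVertexDecomposition H) : Nonempty ι := by
  have hV : (⋃ i, (H i).verts).Nonempty := hH.cover ▸ Set.univ_nonempty
  exact (Set.nonempty_iUnion.1 hV).nonempty

theorem ncard_eq_sum [Finite V] [Fintype ι] (hH : IsVertexDecomposition H) (S : Set V) :
    S.ncard = ∑ i, (S ∩ (H i).verts).ncard := by
  have hdisj : Pairwise (Function.onFun Disjoint fun i ↦ S ∩ (H i).verts) := fun i j hij ↦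
    (hH.disjoint i j hij).mono Set.inter_subset_right Set.inter_subset_right
  rw [← finsum_eq_sum_of_fintype, ← Set.ncard_iUnion_of_finite (fun _ ↦ Set.toFinite _) hdisj,
    ← Set.inter_iUnion, hH.cover, Set.inter_univ]

theorem two_mul_indepNum_le [Finite V] [Finite ι] (hH : IsVertexDecomposition H)
    (hb : ∀ i, IsBistableBipartite (H i).coe) : 2 * G.indepNum ≤ Nat.card V := by
  have := Fintype.ofFinite ι
  obtain ⟨S, hS⟩ := G.exists_isNIndepSet_indepNum
  calc 2 * G.indepNum = ∑ i, 2 * ((S : Set V) ∩ (H i).verts).ncard := by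
        rw [← Finset.mul_sum, ← hH.ncard_eq_sum, Set.ncard_coe_finset, hS.card_eq]
    _ ≤ ∑ i, (H i).verts.ncard := Finset.sum_le_sum fun i _ ↦
        (Nat.mul_le_mul_left 2 (ncard_inter_verts_le_indepNum (H i) hS.isIndepSet)).trans
          (hb i).two_mul_indepNum_le
    _ = Nat.card V := by
        simpa [Set.ncard_univ] using (hH.ncard_eq_sum Set.univ).symm

end IsVertexDecomposition

theorem exists_isVertexDecomposition_of_isPerfectMatching [Finite V] [Nonempty V]
    {M : G.Subgraph} (hM : M.IsPerfectMatching) :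
    ∃ (k : ℕ) (H : Fin k → G.Subgraph), 1 ≤ k ∧ IsVertexDecomposition H ∧
      ∀ i, (H i).IsInduced ∧ IsBistableBipartite (H i).coe := by
  have hdec := isVertexDecomposition_induce_edge hM
  have := hdec.nonempty_index
  refine ⟨Nat.card M.edgeSet, _, Nat.card_pos,
    hdec.comp_equiv (Finite.equivFin M.edgeSet).symm, fun i ↦ ⟨?_, ?_⟩⟩
  · exact (Subgraph.isInduced_iff_exists_eq_induce_top _).2 ⟨_, rfl⟩
  · exact isBistableBipartite_induce_edge (M.edgeSet_subset (Subtype.prop _))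

end Decomposition

theorem proposition5p7_general {V : Type*} [Finite V] [Nonempty V] {G : SimpleGraph V}
    (hiso : ∀ v, ¬G.IsIsolated v) (hbip : G.IsBipartite) :
    List.TFAE [
      IsAlphaPlusStable G,
      ∃ (k : ℕ) (H : Fin k → G.Subgraph), 1 ≤ k ∧ IsVertexDecomposition H ∧
        ∀ i, IsBistableBipartite (H i).coe,
      ∃ (k : ℕ) (H : Fin k → G.Subgraph), 1 ≤ k ∧ IsVertexDecomposition H ∧
        ∀ i, (H i).IsInduced ∧ IsBistableBipartite (H i).coe,
      ∃ M : G.Subgraph, M.IsPerfectMatching,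
      2 * G.indepNum ≤ Nat.card V] := by
  tfae_have 1 → 5 := fun hst ↦ two_mul_indepNum_le_of_subsingleton_indepCore hbip hiso
    (isAlphaPlusStable_iff_subsingleton_indepCore.1 hst)
  tfae_have 5 → 4 := exists_isPerfectMatching_of_two_mul_indepNum_le hbip
  tfae_have 4 → 3 := fun ⟨_, hM⟩ ↦ exists_isVertexDecomposition_of_isPerfectMatching hM
  tfae_have 3 → 2 := fun ⟨k, H, hk, hdec, hH⟩ ↦ ⟨k, H, hk, hdec, fun i ↦ (hH i).2⟩
  tfae_have 2 → 5 := fun ⟨_, _, _, hdec, hH⟩ ↦ hdec.two_mul_indepNum_le hH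
  tfae_have 5 → 1 := isAlphaPlusStable_of_two_mul_indepNum_le hbip
  tfae_finish

/-- A connected bipartite graph with at least two vertices is `α⁺`-stable if and only if it
decomposes into vertex-disjoint bistable bipartite subgraphs covering its vertices, and this is so
both for arbitrary subgraphs and for induced subgraphs as parts. -/
theorem proposition5p7 {V : Type*} [Finite V] [Nontrivial V] (G : SimpleGraph V)
    (hconn : G.Connected) (hbip : G.IsBipartite) :
    (IsAlphaPlusStable G ↔
      ∃ (k : ℕ) (H : Fin k → G.Subgraph), 1 ≤ k ∧ IsVertexDecomposition H ∧
        ∀ i, IsBistableBipartite (H i).coe) ∧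
    (IsAlphaPlusStable G ↔
      ∃ (k : ℕ) (H : Fin k → G.Subgraph), 1 ≤ k ∧ IsVertexDecomposition H ∧
        ∀ i, (H i).IsInduced ∧ IsBistableBipartite (H i).coe) :=
  have h := proposition5p7_general hconn.preconnected.not_isIsolated hbip
  ⟨h.out 0 1, h.out 0 2⟩
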